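/- Let $\mathrm{FI}$ be the category whose objects are the finite sets $[n]=\{1,\dots,n\}$, $n\ge 0$, and whose morphisms are injections. Let $\mathbf{Graph}$ be the category of finite graphs without loops or multiple edges (possibly disconnected) and graph homomorphisms, i.e. maps of vertices that send edges to edges. An $\mathrm{FI}$-graph is a functor $G_\bullet:\mathrm{FI}\to\mathbf{Graph}$; write $G_n$ for its value on $[n]$ and $G(f)$ for the map induced by an injection $f$. It is vertex-stable if there is some $d\ge 0$ such that for all $n\ge d$ and every vertex $v\in V(G_{n+1})$ there are a vertex $w\in V(G_n)$ and an injection $f:[n]\hookrightarrow[n+1]$ with $G(f)(w)=v$. Let $G_\bullet$ be a vertex-stable $\mathrm{FI}$-graph. Then the following invariants, with values in $\mathbb{N}\cup\{\infty\}$, are independent of $n$ for all sufficiently large $n$: 1. the diameter of $G_n$, that is, the supremum of the distances between two vertices of $G_n$ (vertices in different components have distance $\infty$; the empty graph has diameter $0$); 2. the girth of $G_n$, that is, the length of a shortest cycle of $G_n$ ($\infty$ if $G_n$ has no cycle). -/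

import Mathlib

universe u

/-- The category `FI`: its objects are the finite sets `[n]`, `n = 0, 1, 2, …`
(with `[n]` modelled by `Fin n`), its morphisms are the injections between them. -/
structure FI where
  /-- The number `n` of the object `[n]`. -/
  size : ℕ

instance : CategoryTheory.Category FI where
  Hom a b := Fin a.size ↪ Fin b.size
  id a := Function.Embedding.refl (Fin a.size)
  comp f g := f.trans g

/-- A finite graph without loops or multiple edges (possibly disconnected, possibly empty). -/
structure FinGraph where
  /-- The vertex set. -/
  V : Type u
  /-- The vertex set is finite. -/
  finite_V : Finite V
  /-- The edges. -/
  graph : SimpleGraph V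

/-- The category of finite simple graphs and graph homomorphisms, i.e. maps of vertices that
send edges to edges. -/
instance : CategoryTheory.Category FinGraph.{u} where
  Hom G H := G.graph →g H.graph
  id _ := SimpleGraph.Hom.id
  comp f g := g.comp f

/-- An `FI`-graph is a functor from `FI` to finite simple graphs. -/
abbrev FIGraph := CategoryTheory.Functor FI FinGraph.{u}

namespace FIGraph

/-- The vertex set of `G_n`. -/
abbrev Vert (G : FIGraph.{u}) (n : ℕ) : Type u := (G.obj ⟨n⟩).V

/-- The graph `G_n`. -/
abbrev graph (G : FIGraph.{u}) (n : ℕ) : SimpleGraph (G.Vert n) := (G.obj ⟨n⟩).graph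

/-- The transition map `G(f) : G_m → G_n` of an injection `f : [m] ↪ [n]`. -/
def transition (G : FIGraph.{u}) {m n : ℕ} (f : Fin m ↪ Fin n) : G.graph m →g G.graph n :=
  G.map (X := ⟨m⟩) (Y := ⟨n⟩) f

/-- `G` is vertex-stable with stable degree `≤ d`. -/
def VertexStableWith (G : FIGraph.{u}) (d : ℕ) : Prop :=
  ∀ n, d ≤ n → ∀ v : G.Vert (n + 1),
    ∃ (w : G.Vert n) (f : Fin n ↪ Fin (n + 1)), G.transition f w = v

/-- `G` is vertex-stable. -/
def VertexStable (G : FIGraph.{u}) : Prop := ∃ d, G.VertexStableWith d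

end FIGraph

/-! Both invariants are eventually non-increasing in the well-founded order `ℕ∞`. For `n ≥ 2d`, any
two vertices of `G_{n+1}` lift along one common map from `G_n`, and homomorphisms do not increase
distances. For the girth, transition maps are eventually injective, so they send cycles to cycles:
which vertices of `G_d` get identified depends only on finitely many coincidence patterns, and these
identifications grow with `n`, hence stabilise. -/

/-- Two maps into a finite type with the same kernel differ by a permutation of the target. -/
theorem exists_perm_comp_eq_of_ker_eq {α β : Type*} [Finite β] (F F' : α → β)
    (h : ∀ a b, F a = F b ↔ F' a = F' b) : ∃ σ : Equiv.Perm β, ∀ a, σ (F a) = F' a := by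
  classical
  have := Fintype.ofFinite β
  let φ : Set.range F → Set.range F' := fun x => ⟨F' x.2.choose, x.2.choose, rfl⟩
  have hφ : ∀ a, φ ⟨F a, a, rfl⟩ = ⟨F' a, a, rfl⟩ := fun a =>
    Subtype.ext ((h _ _).1 (Exists.choose_spec (⟨a, rfl⟩ : ∃ b, F b = F a)))
  have hbij : Function.Bijective φ := by
    constructor
    · rintro ⟨_, a, rfl⟩ ⟨_, b, rfl⟩ hab
      rw [hφ, hφ] at hab
      exact Subtype.ext ((h a b).2 (congrArg Subtype.val hab))
    · rintro ⟨_, a, rfl⟩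
      exact ⟨_, hφ a⟩
  let e : {x // x ∈ Set.range F} ≃ {x // x ∈ Set.range F'} := Equiv.ofBijective φ hbij
  refine ⟨e.extendSubtype, fun a => ?_⟩
  rw [e.extendSubtype_apply_of_mem (F a) ⟨a, rfl⟩]
  exact congrArg Subtype.val (hφ a)

/-- A sequence in a well-founded order that is eventually non-increasing is eventually constant. -/
theorem eventually_eq_of_eventually_succ_le {α : Type*} [PartialOrder α] [WellFoundedLT α]
    (a : ℕ → α) (N : ℕ) (h : ∀ n, N ≤ n → a (n + 1) ≤ a n) :
    ∃ c, ∀ᶠ n in Filter.atTop, a n = c := by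
  have hb : Antitone fun n => a (N + n) := antitone_nat_of_succ_le fun n => h (N + n) (by omega)
  obtain ⟨m, hm⟩ := WellFoundedGT.monotone_chain_condition
    (⟨fun n => OrderDual.toDual (a (N + n)), fun i j hij => hb hij⟩ : ℕ →o αᵒᵈ)
  refine ⟨a (N + m), Filter.eventually_atTop.2 ⟨N + m, fun n hn => ?_⟩⟩
  have hnm : a (N + m) = a (N + (n - N)) := hm (n - N) (by omega)
  rw [hnm, Nat.add_sub_of_le (by omega)]

namespace SimpleGraph

variable {V W : Type*} {G : SimpleGraph V} {H : SimpleGraph W}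

theorem edist_map_le (φ : G →g H) (u v : V) : H.edist (φ u) (φ v) ≤ G.edist u v := by
  by_cases huv : G.Reachable u v
  · obtain ⟨p, hp⟩ := huv.exists_walk_length_eq_edist
    rw [← hp, ← p.length_map φ]
    exact edist_le _
  · simp [edist_eq_top_of_not_reachable huv]

theorem egirth_le_of_injective (φ : G →g H) (hφ : Function.Injective φ) :
    H.egirth ≤ G.egirth := by
  refine le_egirth.2 fun a w hw => ?_
  rw [← w.length_map φ]
  exact le_egirth.1 le_rfl _ _ (hw.map hφ)

end SimpleGraph

namespace FIGraph

variable {G : FIGraph.{u}}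

theorem transition_trans {l m n : ℕ} (f : Fin l ↪ Fin m) (g : Fin m ↪ Fin n) (w : G.Vert l) :
    G.transition (f.trans g) w = G.transition g (G.transition f w) :=
  congrArg (fun φ : G.graph l →g G.graph n => φ w)
    (G.map_comp (X := ⟨l⟩) (Y := ⟨m⟩) (Z := ⟨n⟩) f g)

theorem transition_refl {n : ℕ} (w : G.Vert n) :
    G.transition (Function.Embedding.refl (Fin n)) w = w :=
  congrArg (fun φ : G.graph n →g G.graph n => φ w) (G.map_id ⟨n⟩)

theorem transition_equiv_injective {n : ℕ} (σ : Equiv.Perm (Fin n)) :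
    Function.Injective (G.transition σ.toEmbedding) := by
  refine Function.LeftInverse.injective (g := G.transition σ.symm.toEmbedding) fun w => ?_
  rw [← transition_trans, ← Equiv.trans_toEmbedding, Equiv.self_trans_symm]
  exact transition_refl w

theorem VertexStableWith.exists_transition_eq {d : ℕ} (hG : G.VertexStableWith d) {n : ℕ}
    (hn : d ≤ n) (v : G.Vert n) : ∃ (w : G.Vert d) (f : Fin d ↪ Fin n), G.transition f w = v := by
  induction n, hn using Nat.le_induction with
  | base => exact ⟨v, _, transition_refl v⟩
  | succ n hn ih =>
    obtain ⟨x, g, rfl⟩ := hG n hn v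
    obtain ⟨w, f, rfl⟩ := ih x
    exact ⟨w, f.trans g, transition_trans f g w⟩

/-- The pairs of indices at which two injections coincide. -/
def coincidences {d n : ℕ} (f g : Fin d ↪ Fin n) : Set (Fin d × Fin d) :=
  {p | f p.1 = g p.2}

theorem coincidences_trans {d m n : ℕ} (f g : Fin d ↪ Fin m) (e : Fin m ↪ Fin n) :
    coincidences (f.trans e) (g.trans e) = coincidences f g := by
  ext p
  simp [coincidences]

/-- As `f` and `g` are injective, their coincidences determine the whole kernel of `Sum.elim f g`.
-/
theorem exists_perm_of_coincidences_eq {d n : ℕ} {f g f' g' : Fin d ↪ Fin n}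
    (h : coincidences f g = coincidences f' g') :
    ∃ σ : Equiv.Perm (Fin n), f.trans σ.toEmbedding = f' ∧ g.trans σ.toEmbedding = g' := by
  have h' : ∀ i j, f i = g j ↔ f' i = g' j := fun i j => Set.ext_iff.1 h (i, j)
  obtain ⟨σ, hσ⟩ := exists_perm_comp_eq_of_ker_eq (Sum.elim f g) (Sum.elim f' g') (by
    rintro (a | a) (b | b)
    · simp
    · simpa using h' a b
    · simpa [eq_comm] using h' b a
    · simp)
  exact ⟨σ, DFunLike.ext _ _ fun i => hσ (.inl i), DFunLike.ext _ _ fun i => hσ (.inr i)⟩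

variable (G) in
/-- The coincidence patterns of pairs of injections `[d] ↪ [n]` that identify two given
vertices of `G_d`. -/
def identifications (d n : ℕ) : Set (G.Vert d × G.Vert d × Set (Fin d × Fin d)) :=
  {t | ∃ f g : Fin d ↪ Fin n, coincidences f g = t.2.2 ∧
    G.transition f t.1 = G.transition g t.2.1}

theorem identifications_mono (d : ℕ) : Monotone (G.identifications d) := by
  rintro m n hmn ⟨w, w', P⟩ ⟨f, g, hP, h⟩
  refine ⟨f.trans (Fin.castLEEmb hmn), g.trans (Fin.castLEEmb hmn), ?_, ?_⟩
  · rw [coincidences_trans, hP]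
  · rw [transition_trans, transition_trans, h]

theorem VertexStableWith.transition_injective {d m n : ℕ} (hG : G.VertexStableWith d)
    (hm : d ≤ m) (h : G.identifications d n ⊆ G.identifications d m) (e : Fin m ↪ Fin n) :
    Function.Injective (G.transition e) := by
  intro x y hxy
  obtain ⟨w, f, rfl⟩ := hG.exists_transition_eq hm x
  obtain ⟨w', g, rfl⟩ := hG.exists_transition_eq hm y
  rw [← transition_trans, ← transition_trans] at hxy
  -- The identification made by `e` already occurs in `G_m` for a pair with the same pattern, hence
  -- for `f, g` up to a permutation of `[m]`, which acts injectively.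
  obtain ⟨f', g', hP, h'⟩ := h (show (w, w', coincidences f g) ∈ _ from
    ⟨_, _, coincidences_trans f g e, hxy⟩)
  obtain ⟨σ, rfl, rfl⟩ := exists_perm_of_coincidences_eq hP.symm
  rw [transition_trans, transition_trans] at h'
  exact transition_equiv_injective σ h'

/-- The transition maps of a vertex-stable `FI`-graph are eventually injective. -/
theorem VertexStable.eventually_transition_injective (hG : G.VertexStable) :
    ∃ N, ∀ m n, N ≤ m → ∀ e : Fin m ↪ Fin n, Function.Injective (G.transition e) := by
  obtain ⟨d, hd⟩ := hG
  have : Finite (G.Vert d) := (G.obj ⟨d⟩).finite_V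
  obtain ⟨N, hN⟩ := WellFoundedGT.monotone_chain_condition
    (⟨G.identifications d, identifications_mono d⟩ : ℕ →o _)
  refine ⟨max d N, fun m n hm e => hd.transition_injective (by omega) ?_ e⟩
  have hmn : m ≤ n := by simpa using Fintype.card_le_of_embedding e
  exact ((hN n (by omega)).symm.trans (hN m (by omega))).subset

theorem VertexStableWith.exists_common_transition_eq {d n : ℕ} (hG : G.VertexStableWith d)
    (hn : 2 * d ≤ n) (u v : G.Vert (n + 1)) :
    ∃ (e : Fin n ↪ Fin (n + 1)) (x y : G.Vert n), G.transition e x = u ∧ G.transition e y = v := by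
  obtain ⟨w, f, rfl⟩ := hG.exists_transition_eq (by omega) u
  obtain ⟨w', g, rfl⟩ := hG.exists_transition_eq (by omega) v
  -- The two images cover at most `2d < n + 1` points; both injections factor through the complement
  -- of a missed point.
  obtain ⟨a, ha⟩ : ∃ a, a ∉ Set.range (Sum.elim f g) := by
    by_contra! h
    have := Fintype.card_le_of_surjective (Sum.elim f g) h
    simp only [Fintype.card_fin, Fintype.card_sum] at this
    omega
  have key (k : Fin d ↪ Fin (n + 1)) (hk : ∀ i, k i ≠ a) :
      ∃ k' : Fin d ↪ Fin n, k'.trans (Fin.succAboveEmb a) = k := by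
    choose k' hk' using fun i => Fin.exists_succAbove_eq (hk i)
    exact ⟨⟨k', fun i j hij => k.injective (by rw [← hk', ← hk', hij])⟩, DFunLike.ext _ _ hk'⟩
  obtain ⟨f', rfl⟩ := key f fun i hi => ha ⟨.inl i, hi⟩
  obtain ⟨g', rfl⟩ := key g fun i hi => ha ⟨.inr i, hi⟩
  exact ⟨_, _, _, (transition_trans _ _ _).symm, (transition_trans _ _ _).symm⟩

theorem VertexStableWith.ediam_succ_le {d n : ℕ} (hG : G.VertexStableWith d) (hn : 2 * d ≤ n) :
    (G.graph (n + 1)).ediam ≤ (G.graph n).ediam := by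
  refine SimpleGraph.ediam_le_of_edist_le fun u v => ?_
  obtain ⟨e, x, y, rfl, rfl⟩ := hG.exists_common_transition_eq hn u v
  exact (SimpleGraph.edist_map_le _ x y).trans SimpleGraph.edist_le_ediam

end FIGraph

theorem mainTheorem10 (G : FIGraph.{u}) (hG : G.VertexStable) :
    (∃ D : ℕ∞, ∀ᶠ n : ℕ in Filter.atTop, (G.graph n).ediam = D) ∧
    (∃ g : ℕ∞, ∀ᶠ n : ℕ in Filter.atTop, (G.graph n).egirth = g) := by
  constructor
  · obtain ⟨d, hd⟩ := hG
    exact eventually_eq_of_eventually_succ_le _ (2 * d) fun n hn => hd.ediam_succ_le hn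
  · obtain ⟨N, hN⟩ := hG.eventually_transition_injective
    exact eventually_eq_of_eventually_succ_le _ N fun n hn =>
      SimpleGraph.egirth_le_of_injective _ (hN n (n + 1) hn (Fin.castLEEmb n.le_succ))
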